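/- Let $D$ be a probability distribution on $V\times V$, $V=\{1,\dots,n\}$, with $p(u,v)=D(u,v)$, and let $X$ and $Y$ be the source and the destination of a request $(X,Y)\sim D$. The demand graph $G_D$ is the directed graph on $V$ with an arc $(u,v)$ (possibly a loop) whenever $p(u,v)>0$. Call $D$ uniform if $p(u,v)=1/m$ for every arc $(u,v)$, where $m$ is the number of arcs, and $r$-regular if every node of $G_D$ has out-degree $r$ and in-degree $r$. For an undirected graph $N$ on $V$ put $\mathrm{EPL}(D,N)=\sum_{u,v}p(u,v)\,d_N(u,v)$, where $d_N(u,v)=\infty$ if $u$ and $v$ are not connected in $N$ (and $0\cdot\infty=0$), and let $H(Y|X)=\sum_{u,v}p(u,v)\log_2\frac1{p(v\mid u)}$ and $H(X|Y)=\sum_{u,v}p(u,v)\log_2\frac1{p(u\mid v)}$ denote the conditional entropies. There are absolute constants $\Delta\in\mathbb N$ and $K>0$ such that for every $n$ and every distribution $D$ on $V\times V$ that is uniform and $r$-regular with $r\ge 2$ the following hold. (i) If $c\ge 1$ is a real number and every node of $G_D$ has degree (in-degree plus out-degree) at least $n^{1/c}$, then there is a graph $N$ on $V$ of maximum degree at most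 $\Delta$ with $\mathrm{EPL}(D,N)\le K\,c\,\bigl(H(Y|X)+H(X|Y)\bigr)$. (ii) If $G_D$, ignoring directions and loops, is isomorphic to a hypercube, then there is a graph $N$ on $V$ of maximum degree at most $\Delta$ with $\mathrm{EPL}(D,N)\le K\bigl(H(Y|X)+H(X|Y)\bigr)$. (iii) If $G_D$, ignoring directions and loops, is chordal (every cycle of length at least $4$ has a chord), then there is a graph $N$ on $V$ of maximum degree at most $\Delta$ with $\mathrm{EPL}(D,N)\le K\bigl(H(Y|X)+H(X|Y)\bigr)$. -/

import Mathlib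

open scoped ENNReal

noncomputable section

namespace DAN

/-- A distribution `D` of communication requests over `V × V`; `D (u, v)` is the
probability `p(u, v)` of a request from source `u` to destination `v`. -/
abbrev Demand (V : Type*) := PMF (V × V)

section Demand

variable {V : Type*} [Fintype V] (D : Demand V)

/-- The probability `p(u, v)` as a real number. -/
def prob (u v : V) : ℝ := (D (u, v)).toReal

/-- The marginal probability that `u` is the source of a request. -/
def srcProb (u : V) : ℝ := ∑ v, prob D u v

/-- The marginal probability that `v` is the destination of a request. -/
def dstProb (v : V) : ℝ := ∑ u, prob D u v

/-- The conditional entropy `H(Y | X)` (binary logarithm) of the destination `Y` given the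
source `X`: the sum of `p(u, v) log₂ (1 / p(v | u))`, where terms with `p(u, v) = 0` vanish. -/
def condEntropyDstSrc : ℝ :=
  ∑ u, ∑ v, prob D u v * Real.logb 2 (1 / (prob D u v / srcProb D u))

/-- The conditional entropy `H(X | Y)` (binary logarithm) of the source `X` given the
destination `Y`: the sum of `p(u, v) log₂ (1 / p(u | v))`, where terms with `p(u, v) = 0`
vanish. -/
def condEntropySrcDst : ℝ :=
  ∑ u, ∑ v, prob D u v * Real.logb 2 (1 / (prob D u v / dstProb D v))

/-- The arcs of the demand graph `G_D`: the pairs `(u, v)` with `p(u, v) > 0`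
(a loop `(u, u)` is possible). -/
def arcs : Set (V × V) := {e | 0 < D e}

/-- The out-degree of `v` in the demand graph. -/
def outDegree (v : V) : ℕ := {w | (v, w) ∈ arcs D}.ncard

/-- The in-degree of `v` in the demand graph. -/
def inDegree (v : V) : ℕ := {w | (w, v) ∈ arcs D}.ncard

/-- `D` is `r`-regular: all out-degrees and all in-degrees of the demand graph are `r`. -/
def IsRegular (r : ℕ) : Prop := ∀ v, outDegree D v = r ∧ inDegree D v = r

/-- `D` is uniform: every request of positive probability has probability `1 / m`, where `m`
is the number of arcs of the demand graph. -/
def IsUniform : Prop := ∀ e ∈ arcs D, D e = ((arcs D).ncard : ℝ≥0∞)⁻¹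

/-- The undirected graph underlying the demand graph: directions and loops are ignored. -/
def demandGraph : SimpleGraph V where
  Adj u v := u ≠ v ∧ ((u, v) ∈ arcs D ∨ (v, u) ∈ arcs D)
  symm := ⟨fun _ _ h => ⟨h.1.symm, h.2.symm⟩⟩
  loopless := ⟨fun _ h => h.1 rfl⟩

/-- The expected path length of the requests of `D` in the host network `N`. The distance of
disconnected nodes is `∞`, so a finite value forces `N` to connect every pair that
communicates. -/
def epl (N : SimpleGraph V) : ℝ≥0∞ := ∑ u, ∑ v, D (u, v) * (N.edist u v : ℝ≥0∞)

end Demand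

/-- Every vertex of `N` has at most `Δ` neighbours. -/
def DegreeBounded {V : Type*} (N : SimpleGraph V) (Δ : ℕ) : Prop :=
  ∀ v, (N.neighborSet v).encard ≤ Δ

/-- The `d`-dimensional hypercube: bit strings of length `d`, adjacent when they differ in
exactly one position. -/
def hypercube (d : ℕ) : SimpleGraph (Fin d → Bool) where
  Adj x y := hammingDist x y = 1
  symm := ⟨fun x y h => by rw [hammingDist_comm]; exact h⟩
  loopless := ⟨fun x h => by simp at h⟩

/-- A graph is chordal if every cycle of length at least four has a chord: an edge between two
vertices of the cycle that is not an edge of the cycle. -/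
def IsChordal {V : Type*} (G : SimpleGraph V) : Prop :=
  ∀ (v : V) (c : G.Walk v v), c.IsCycle → 4 ≤ c.length →
    ∃ x ∈ c.support, ∃ y ∈ c.support, G.Adj x y ∧ s(x, y) ∉ c.edges

end DAN

end

/-!
For a uniform `r`-regular demand each of the two conditional entropies is `log₂ r`, so a network of
bounded degree has to be found in which all edges of the demand graph are routed along paths of
length `O(log r)`. The demand graph has degrees at most `2 r`.

All networks are unions of at most three networks of one kind (`exists_heap_network`): given a map
`f` on the nodes, put a binary heap on each fibre of `f`. This has maximum degree `3` and joins nodes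
of the same fibre by paths of length at most twice the logarithm of the size of the fibre.

* If `n ^ (1 / c) ≤ 2 r`, then `log n ≤ 2 c log r`, and one heap on all nodes suffices.
* For the `d`-dimensional cube, where `d ≤ 2 r`, the first `⌈log₂ d⌉` coordinates are an address
  that names a coordinate. Heaps join the nodes that differ only in their address, and a matching
  joins each node to the one that differs from it in the named coordinate; any coordinate is then
  flipped by moving to its address, flipping, and moving back (`exists_hypercube_network`).
* In a chordal graph, consider the distance levels from a root of each connected component. The
  neighbours one level below a connected component of a level form a clique, since minimal
  separators of chordal graphs are cliques (`IsChordal.adj_of_level`). With degrees at most `s`,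
  such a component therefore has at most `(s + 1) s` vertices. Heaps on the components of the levels
  route the edges inside levels. If an edge goes from `u` down to `v`, then the chosen parent
  of `u` and `v` are equal or adjacent, so that it is enough to join each vertex to its parent. The
  stars of a parent and its children are disjoint once odd and even levels are treated separately,
  and heaps on these stars do this (`IsChordal.exists_network`).
-/

namespace DAN

/-! ### Networks of heaps -/

/-- Each fibre of `f` can be numbered by an initial segment of the positive integers. -/
lemma exists_fiber_numbering {V I : Type*} [Fintype V] (f : V → I) :
    ∃ h : V → ℕ, (∀ u v, f u = f v → h u = h v → u = v) ∧
      (∀ v, 1 ≤ h v ∧ h v ≤ {w | f w = f v}.ncard) ∧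
      ∀ v k, 1 ≤ k → k ≤ h v → ∃ u, f u = f v ∧ h u = k := by
  classical
  let e : ∀ i, {w // f w = i} ≃ Fin (Fintype.card {w // f w = i}) := fun i => Fintype.equivFin _
  have card_eq (v : V) : Fintype.card {w // f w = f v} = {w | f w = f v}.ncard := by
    rw [← Nat.card_coe_set_eq, ← Nat.card_eq_fintype_card]; rfl
  have val_eq : ∀ v i (hv : f v = i), (e (f v) ⟨v, rfl⟩ : ℕ) = e i ⟨v, hv⟩ := by
    rintro v _ rfl
    rfl
  refine ⟨fun v => (e (f v) ⟨v, rfl⟩ : ℕ) + 1, fun u v huv h => ?_,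
    fun v => ⟨Nat.le_add_left _ _, ?_⟩, fun v k hk hkv => ?_⟩
  · simp only [add_left_inj, val_eq u _ huv] at h
    simpa using (e (f v)).injective (Fin.ext h)
  · rw [← card_eq]
    exact (e (f v) ⟨v, rfl⟩).2
  · have hlt : k - 1 < Fintype.card {w // f w = f v} := by
      have := (e (f v) ⟨v, rfl⟩).2
      simp only at hkv
      omega
    obtain ⟨⟨u, hfu⟩, hu⟩ := (e (f v)).surjective ⟨k - 1, hlt⟩
    refine ⟨u, hfu, ?_⟩
    simp only [val_eq u _ hfu, hu]
    omega

/-- The binary heaps on the fibres of `f`, as a network: nodes of the same fibre are joined by a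
route that is logarithmic in the size of the fibre. -/
lemma exists_heap_network {V I : Type*} [Fintype V] (f : V → I) (M : ℕ)
    (hM : ∀ v, {w | f w = f v}.ncard ≤ M) :
    ∃ N : SimpleGraph V, DegreeBounded N 3 ∧
      ∀ u v, f u = f v → N.edist u v ≤ (2 * Nat.log 2 M : ℕ) := by
  obtain ⟨h, hinj, hbd, hsurj⟩ := exists_fiber_numbering f
  let N : SimpleGraph V :=
    { Adj := fun u v => u ≠ v ∧ f u = f v ∧ (h u = h v / 2 ∨ h v = h u / 2)
      symm := ⟨fun _ _ h => ⟨h.1.symm, h.2.1.symm, h.2.2.symm⟩⟩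
      loopless := ⟨fun _ h => h.1 rfl⟩ }
  -- climbing from a node to the node numbered `1` of its fibre halves the number at each step
  have root (k : ℕ) : ∀ v, h v = k →
      ∃ u, f u = f v ∧ h u = 1 ∧ N.edist v u ≤ (Nat.log 2 k : ℕ) := by
    induction k using Nat.strong_induction_on with
    | _ k ih =>
      intro v hv
      have h1 := (hbd v).1
      by_cases hk : k = 1
      · exact ⟨v, rfl, by omega, by simp⟩
      · obtain ⟨w, hw, hwk⟩ := hsurj v (k / 2) (by omega) (by omega)
        obtain ⟨u, hu, hu1, hd⟩ := ih (k / 2) (by omega) w hwk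
        refine ⟨u, hu.trans hw, hu1, ?_⟩
        have hadj : N.Adj v w := by
          refine ⟨?_, hw.symm, Or.inr (by omega)⟩
          rintro rfl
          omega
        calc N.edist v u ≤ N.edist v w + N.edist w u := SimpleGraph.edist_triangle
          _ ≤ 1 + (Nat.log 2 (k / 2) : ℕ) := by
              gcongr
              exact (SimpleGraph.edist_eq_one_iff_adj.2 hadj).le
          _ = (Nat.log 2 k : ℕ) := by
              rw [Nat.log_of_one_lt_of_le (b := 2) (n := k) (by omega) (by omega)]
              push_cast
              rw [add_comm]
  refine ⟨N, fun v => ?_, fun u v huv => ?_⟩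
  · have hmaps : Set.MapsTo h (N.neighborSet v) ({h v / 2, 2 * h v, 2 * h v + 1} : Set ℕ) := by
      intro w hw
      have := hw.2.2
      simp only [Set.mem_insert_iff, Set.mem_singleton_iff]
      omega
    have hi : Set.InjOn h (N.neighborSet v) := fun a ha b hb hab =>
      hinj a b (ha.2.1.symm.trans hb.2.1) hab
    refine (Set.encard_le_encard_of_injOn hmaps hi).trans ?_
    refine (Set.encard_insert_le _ _).trans ?_
    refine (add_le_add_left (Set.encard_insert_le _ _) 1).trans ?_
    rw [Set.encard_singleton]
    norm_num
  · obtain ⟨a, ha, ha1, hda⟩ := root _ u rfl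
    obtain ⟨b, hb, hb1, hdb⟩ := root _ v rfl
    obtain rfl : a = b := hinj _ _ (ha.trans (huv.trans hb.symm)) (ha1.trans hb1.symm)
    have hu : Nat.log 2 (h u) ≤ Nat.log 2 M := Nat.log_mono_right ((hbd u).2.trans (hM u))
    have hv : Nat.log 2 (h v) ≤ Nat.log 2 M := Nat.log_mono_right ((hbd v).2.trans (hM v))
    calc N.edist u v ≤ N.edist u a + N.edist a v := SimpleGraph.edist_triangle
      _ ≤ (Nat.log 2 (h u) : ℕ) + (Nat.log 2 (h v) : ℕ) := by
          rw [SimpleGraph.edist_comm (u := a)]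
          gcongr
      _ ≤ (2 * Nat.log 2 M : ℕ) := by
          norm_cast
          omega

lemma DegreeBounded.mono {V : Type*} {N : SimpleGraph V} {a b : ℕ} (h : DegreeBounded N a)
    (hab : a ≤ b) : DegreeBounded N b :=
  fun v => (h v).trans (by exact_mod_cast hab)

lemma DegreeBounded.sup {V : Type*} {N N' : SimpleGraph V} {a b : ℕ} (h : DegreeBounded N a)
    (h' : DegreeBounded N' b) : DegreeBounded (N ⊔ N') (a + b) := by
  intro v
  have : (N ⊔ N').neighborSet v = N.neighborSet v ∪ N'.neighborSet v := by
    ext w; simp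
  rw [this]
  push_cast
  exact (Set.encard_union_le _ _).trans (add_le_add (h v) (h' v))

/-! ### Uniform regular demands -/

lemma IsUniform.prob_eq {V : Type*} {D : Demand V} (hD : IsUniform D) (u v : V) :
    prob D u v = Set.indicator {e | e ∈ arcs D} (fun _ => ((arcs D).ncard : ℝ)⁻¹) (u, v) := by
  by_cases h : (u, v) ∈ arcs D
  · simp [h, prob, hD _ h]
  · have : D (u, v) = 0 := by simpa [arcs] using h
    simp [h, prob, this]

section Demand

variable {V : Type*} [Fintype V] (D : Demand V)

lemma sum_prob : ∑ u, ∑ v, prob D u v = 1 := by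
  have h : ∑ e, D e = 1 := by rw [← tsum_fintype (L := .unconditional _)]; exact D.tsum_coe
  have h' : ∑ e : V × V, (D e).toReal = 1 := by
    rw [← ENNReal.toReal_sum fun e _ => D.apply_ne_top e, h, ENNReal.toReal_one]
  rw [← h', Fintype.sum_prod_type]
  rfl

variable {D}

lemma epl_le_of_edist_le {N : SimpleGraph V} {B : ℕ}
    (h : ∀ u v, (u, v) ∈ arcs D → N.edist u v ≤ B) : epl D N ≤ B := by
  have hsum : ∑ e, D e = 1 := by rw [← tsum_fintype (L := .unconditional _)]; exact D.tsum_coe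
  calc epl D N ≤ ∑ u, ∑ v, D (u, v) * (B : ℝ≥0∞) := by
        refine Finset.sum_le_sum fun u _ => Finset.sum_le_sum fun v _ => ?_
        by_cases he : (u, v) ∈ arcs D
        · gcongr
          exact_mod_cast ENat.toENNReal_le.2 (h u v he)
        · have : D (u, v) = 0 := by simpa [arcs] using he
          simp [this]
    _ = B := by
        rw [← Fintype.sum_prod_type' fun u v => D (u, v) * (B : ℝ≥0∞), ← Finset.sum_mul]
        simp [hsum]

lemma sum_indicator_const {s : Set V} (c : ℝ) :
    ∑ v, s.indicator (fun _ => c) v = s.ncard * c := by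
  classical
  rw [Finset.sum_indicator_eq_sum_filter, Finset.sum_const, nsmul_eq_mul,
    ← Set.ncard_coe_finset]
  simp

variable {r : ℕ}

lemma srcProb_eq (hD : IsUniform D) (hr : IsRegular D r) (u : V) :
    srcProb D u = r * ((arcs D).ncard : ℝ)⁻¹ := by
  rw [← (hr u).1, outDegree, ← sum_indicator_const, srcProb]
  exact Finset.sum_congr rfl fun v _ => hD.prob_eq u v

lemma dstProb_eq (hD : IsUniform D) (hr : IsRegular D r) (v : V) :
    dstProb D v = r * ((arcs D).ncard : ℝ)⁻¹ := by
  rw [← (hr v).2, inDegree, ← sum_indicator_const, dstProb]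
  exact Finset.sum_congr rfl fun u _ => hD.prob_eq u v

/-- Given either end of a request, the other end is uniform on `r` nodes. -/
lemma prob_mul_logb (hD : IsUniform D) (u v : V) :
    prob D u v * Real.logb 2 (1 / (prob D u v / (r * ((arcs D).ncard : ℝ)⁻¹))) =
      prob D u v * Real.logb 2 r := by
  rw [hD.prob_eq]
  by_cases h : (u, v) ∈ arcs D
  · have hm : ((arcs D).ncard : ℝ) ≠ 0 := by
      simpa using (Set.ncard_pos (Set.toFinite _)).2 ⟨_, h⟩ |>.ne'
    simp [h, hm]
  · simp [h]

lemma condEntropy_add (hD : IsUniform D) (hr : IsRegular D r) :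
    condEntropyDstSrc D + condEntropySrcDst D = 2 * Real.logb 2 r := by
  simp only [condEntropyDstSrc, condEntropySrcDst, srcProb_eq hD hr, dstProb_eq hD hr,
    prob_mul_logb hD, ← Finset.sum_mul, sum_prob]
  ring

lemma IsRegular.ncard_neighborSet_le (hr : IsRegular D r) (v : V) :
    ((demandGraph D).neighborSet v).ncard ≤ 2 * r := by
  have : (demandGraph D).neighborSet v ⊆ {w | (v, w) ∈ arcs D} ∪ {w | (w, v) ∈ arcs D} :=
    fun w hw => hw.2
  refine (Set.ncard_le_ncard this (Set.toFinite _)).trans ((Set.ncard_union_le _ _).trans ?_)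
  have h1 := (hr v).1
  have h2 := (hr v).2
  simp only [outDegree, inDegree] at h1 h2
  omega

/-- It suffices to bound the length of the route of each edge of the demand graph. -/
lemma epl_le_of_demandGraph {N : SimpleGraph V} {B : ℕ}
    (h : ∀ u v, (demandGraph D).Adj u v → N.edist u v ≤ B) : epl D N ≤ B := by
  refine epl_le_of_edist_le fun u v huv => ?_
  by_cases he : u = v
  · simp [he]
  · exact h u v ⟨he, Or.inl huv⟩

end Demand

/-! ### Levels of a chordal graph -/

section Chordal

variable {V : Type*} {G : SimpleGraph V}

/-- A shortest walk has no chord. -/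
lemma isChordless_of_length_eq_dist {u v : V} {p : G.Walk u v} (hp : p.length = G.dist u v) :
    p.IsChordless := by
  have key : ∀ i j, i ≤ j → j ≤ p.length → G.Adj (p.getVert i) (p.getVert j) →
      s(p.getVert i, p.getVert j) ∈ p.edges := by
    intro i j hij hj hadj
    have hne : i ≠ j := by rintro rfl; exact hadj.ne rfl
    have hle := SimpleGraph.dist_le ((p.take i).append ((p.drop j).cons hadj))
    simp only [SimpleGraph.Walk.length_append, SimpleGraph.Walk.length_cons,
      SimpleGraph.Walk.take_length, SimpleGraph.Walk.drop_length] at hle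
    obtain rfl : j = i + 1 := by omega
    have := p.toSubgraph_adj_getVert (i := i) (by omega)
    rwa [SimpleGraph.Walk.adj_toSubgraph_iff_mem_edges] at this
  rw [SimpleGraph.Walk.isChordless_iff_forall_mem_edges]
  intro a b ha hb hadj
  obtain ⟨i, rfl, hi⟩ := SimpleGraph.Walk.mem_support_iff_exists_getVert.1 ha
  obtain ⟨j, rfl, hj⟩ := SimpleGraph.Walk.mem_support_iff_exists_getVert.1 hb
  rcases le_total i j with h | h
  · exact key i j h hj hadj
  · rw [Sym2.eq_swap]
    exact key j i h hi hadj.symm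

variable (G) in
/-- The graph `G` with only those of its edges that have both ends in `S`. -/
def edgesWithin (S : Set V) : SimpleGraph V where
  Adj u v := G.Adj u v ∧ u ∈ S ∧ v ∈ S
  symm := ⟨fun _ _ h => ⟨h.1.symm, h.2.2, h.2.1⟩⟩
  loopless := ⟨fun _ h => G.irrefl h.1⟩

lemma edgesWithin_le (S : Set V) : edgesWithin G S ≤ G := fun _ _ h => h.1

lemma mem_of_mem_support_edgesWithin {S : Set V} {u v : V} (p : (edgesWithin G S).Walk u v)
    (hu : u ∈ S) {w : V} (hw : w ∈ p.support) : w ∈ S := by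
  induction p with
  | nil => simp_all
  | cons h p ih =>
    rw [SimpleGraph.Walk.support_cons, List.mem_cons] at hw
    rcases hw with rfl | hw
    · exact hu
    · exact ih h.2.2 hw

/-- Two nonadjacent vertices connected inside `S` are joined by a chordless path of length at
least two inside `S`. -/
lemma exists_chordless_path {S : Set V} {x y : V} (hx : x ∈ S) (hne : x ≠ y)
    (hadj : ¬ G.Adj x y) (h : (edgesWithin G S).Reachable x y) :
    ∃ p : G.Walk x y, p.IsPath ∧ 2 ≤ p.length ∧ (∀ w ∈ p.support, w ∈ S) ∧ p.IsChordless := by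
  obtain ⟨p, hp, hlen⟩ := h.exists_path_of_dist
  have hS : ∀ w ∈ p.support, w ∈ S := fun w hw => mem_of_mem_support_edgesWithin p hx hw
  refine ⟨p.mapLe (edgesWithin_le S), hp.mapLe _, ?_, ?_, ?_⟩
  · have := h.one_lt_dist_of_ne_of_not_adj hne fun h => hadj h.1
    rw [SimpleGraph.Walk.length_mapLe]
    omega
  · simpa using hS
  · have hc := SimpleGraph.Walk.isChordless_iff_forall_mem_edges.1
      (isChordless_of_length_eq_dist hlen)
    rw [SimpleGraph.Walk.isChordless_iff_forall_mem_edges]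
    intro a b ha hb hab
    rw [SimpleGraph.Walk.support_mapLe_eq_support] at ha hb
    rw [SimpleGraph.Walk.edges_mapLe_eq_edges]
    exact hc ha hb ⟨hab, hS a ha, hS b hb⟩

/-- Minimal separators of a chordal graph are cliques: if `x` and `y` are connected through each
of two sets that have no edge between them, then `x` and `y` are adjacent. -/
lemma IsChordal.adj_of_reachable (hG : IsChordal G) {A B : Set V} {x y : V} (hne : x ≠ y)
    (hdisj : Disjoint A B) (hAB : ∀ a ∈ A, ∀ b ∈ B, ¬ G.Adj a b)
    (hA : (edgesWithin G (A ∪ {x, y})).Reachable x y)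
    (hB : (edgesWithin G (B ∪ {x, y})).Reachable x y) : G.Adj x y := by
  by_contra hadj
  obtain ⟨p, hp, hp2, hpS, hpc⟩ := exists_chordless_path (by simp) hne hadj hA
  obtain ⟨q, hq, hq2, hqS, hqc⟩ := exists_chordless_path (by simp) hne hadj hB
  rw [SimpleGraph.Walk.isChordless_iff_forall_mem_edges] at hpc hqc
  have hcyc : (p.append q.reverse).IsCycle := by
    refine hp.isCycle_append hq.reverse ?_ (Or.inl (by omega))
    intro w hwp hwq
    have hxp : x ∉ p.support.tail := by
      have := hp.support_nodup
      rw [← SimpleGraph.Walk.cons_tail_support, List.nodup_cons] at this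
      exact this.1
    have hyq : y ∉ q.reverse.support.tail := by
      have := hq.reverse.support_nodup
      rw [← SimpleGraph.Walk.cons_tail_support, List.nodup_cons] at this
      exact this.1
    have h1 := hpS w (List.mem_of_mem_tail hwp)
    have h2 := hqS w (by simpa using List.mem_of_mem_tail hwq)
    have hwx : w ≠ x := by rintro rfl; exact hxp hwp
    have hwy : w ≠ y := by rintro rfl; exact hyq hwq
    simp only [Set.mem_union, Set.mem_insert_iff, Set.mem_singleton_iff, hwx, hwy,
      or_false] at h1 h2
    exact Set.disjoint_left.1 hdisj h1 h2
  obtain ⟨a, ha, b, hb, hab, hnot⟩ := hG x _ hcyc (by simp; omega)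
  simp only [SimpleGraph.Walk.mem_support_append_iff, SimpleGraph.Walk.support_reverse,
    List.mem_reverse] at ha hb
  simp only [SimpleGraph.Walk.edges_append, SimpleGraph.Walk.edges_reverse, List.mem_append,
    List.mem_reverse, not_or] at hnot
  -- a vertex of the cycle outside `B` is on `p`, and one outside `A` is on `q`
  have side : ∀ w, w ∈ p.support ∨ w ∈ q.support →
      (w ∈ A ∨ w ∈ q.support) ∧ (w ∈ B ∨ w ∈ p.support) := by
    rintro w (hw | hw)
    · refine ⟨?_, Or.inr hw⟩
      rcases hpS w hw with h | rfl | rfl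
      · exact Or.inl h
      · simp
      · simp
    · refine ⟨Or.inr hw, ?_⟩
      rcases hqS w hw with h | rfl | rfl
      · exact Or.inl h
      · simp
      · simp
  by_cases hpp : a ∈ p.support ∧ b ∈ p.support
  · exact hnot.1 (hpc hpp.1 hpp.2 hab)
  by_cases hqq : a ∈ q.support ∧ b ∈ q.support
  · exact hnot.2 (hqc hqq.1 hqq.2 hab)
  have ha' := side a ha
  have hb' := side b hb
  have h1 := hAB a
  have h2 := hAB b
  have h3 := hab.symm
  grind

variable (G) in
/-- A chosen vertex of the connected component of `v`. -/
noncomputable def root (v : V) : V := (G.connectedComponentMk v).out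

variable (G) in
/-- The distance of `v` from the chosen vertex of its connected component. -/
noncomputable def level (v : V) : ℕ := G.dist (root G v) v

lemma reachable_root (v : V) : G.Reachable (root G v) v :=
  SimpleGraph.ConnectedComponent.exact (Quot.out_eq _)

lemma root_eq_of_reachable {u v : V} (h : G.Reachable u v) : root G u = root G v := by
  rw [root, root, SimpleGraph.ConnectedComponent.sound h]

lemma level_le_of_adj {u v : V} (h : G.Adj u v) : level G v ≤ level G u + 1 := by
  have := (reachable_root (G := G) u).dist_triangle_left v
  rw [SimpleGraph.dist_eq_one_iff_adj.2 h] at this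
  rw [level, ← root_eq_of_reachable h.reachable]
  exact this

lemma eq_root_of_level_eq_zero {v : V} (h : level G v = 0) : root G v = v :=
  (reachable_root v).dist_eq_zero_iff.1 h

lemma exists_adj_level {v : V} (h : level G v ≠ 0) :
    ∃ u, G.Adj v u ∧ level G u + 1 = level G v := by
  obtain ⟨a, ha⟩ : ∃ a, root G v = a := ⟨_, rfl⟩
  have hr := reachable_root (G := G) v
  rw [level, ha, SimpleGraph.dist_comm] at h
  rw [ha] at hr
  obtain ⟨p, hp⟩ := hr.symm.exists_walk_length_eq_dist
  cases p with
  | nil => exact absurd hp.symm h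
  | @cons _ u _ hadj p =>
    refine ⟨u, hadj, ?_⟩
    have h1 := SimpleGraph.dist_le p
    have h2 := level_le_of_adj hadj.symm
    have h3 : level G u = G.dist u a := by
      rw [level, ← root_eq_of_reachable hadj.reachable, ha, SimpleGraph.dist_comm]
    have h4 : level G v = p.length + 1 := by
      rw [level, ha, SimpleGraph.dist_comm, ← hp, SimpleGraph.Walk.length_cons]
    omega

variable (G) in
open Classical in
/-- A neighbour of `v` one level below, or `v` itself on level zero. -/
noncomputable def parent (v : V) : V :=
  if h : level G v ≠ 0 then (exists_adj_level h).choose else v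

lemma adj_parent {v : V} (h : level G v ≠ 0) : G.Adj v (parent G v) := by
  rw [parent, dif_pos h]
  exact (exists_adj_level h).choose_spec.1

lemma level_parent {v : V} (h : level G v ≠ 0) : level G (parent G v) + 1 = level G v := by
  rw [parent, dif_pos h]
  exact (exists_adj_level h).choose_spec.2

variable (G) in
/-- The edges of `G` between vertices of the same level. -/
def levelGraph : SimpleGraph V where
  Adj u v := G.Adj u v ∧ level G u = level G v
  symm := ⟨fun _ _ h => ⟨h.1.symm, h.2.symm⟩⟩
  loopless := ⟨fun _ h => G.irrefl h.1⟩

lemma levelGraph_le : levelGraph G ≤ G := fun _ _ h => h.1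

lemma reachable_of_levelGraph {S : Set V} {u v : V} (h : (levelGraph G).Reachable u v)
    (hS : ∀ w, level G w = level G u → w ∈ S) :
    level G v = level G u ∧ (edgesWithin G S).Reachable u v := by
  obtain ⟨p⟩ := h
  induction p with
  | nil => exact ⟨rfl, .refl _⟩
  | cons hadj p ih =>
    obtain ⟨h1, h2⟩ := ih fun w hw => hS w (hw.trans hadj.2.symm)
    refine ⟨h1.trans hadj.2.symm, .trans (SimpleGraph.Adj.reachable ?_) h2⟩
    exact ⟨hadj.1, hS _ rfl, hS _ hadj.2.symm⟩

lemma reachable_root_edgesWithin {S : Set V} {v : V} (hv : v ∈ S)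
    (hS : ∀ w, level G w < level G v → w ∈ S) : (edgesWithin G S).Reachable v (root G v) := by
  induction hk : level G v using Nat.strong_induction_on generalizing v with
  | _ k ih =>
    by_cases h0 : level G v = 0
    · rw [eq_root_of_level_eq_zero h0]
    · have h1 := level_parent h0
      have h2 : parent G v ∈ S := hS _ (by omega)
      rw [root_eq_of_reachable (adj_parent h0).reachable]
      refine .trans (SimpleGraph.Adj.reachable ⟨adj_parent h0, hv, h2⟩)
        (ih (level G (parent G v)) (by omega) h2 (fun w hw => hS w (by omega)) rfl)

/-- The neighbours one level below a component of a level of a chordal graph form a clique: they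
are connected through this component, and through the levels below them. -/
lemma IsChordal.adj_of_level (hG : IsChordal G) {u v x y : V}
    (huv : (levelGraph G).Reachable u v) (hux : G.Adj u x) (hvy : G.Adj v y)
    (hx : level G x + 1 = level G u) (hy : level G y + 1 = level G v) (hne : x ≠ y) :
    G.Adj x y := by
  have hlev := (reachable_of_levelGraph (S := Set.univ) huv (by simp)).1
  refine hG.adj_of_reachable (A := {w | level G w = level G u}) (B := {w | level G w < level G x})
    hne ?_ ?_ ?_ ?_
  · rw [Set.disjoint_left]
    intro w h1 h2
    simp only [Set.mem_ofPred_eq] at h1 h2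
    omega
  · intro a ha b hb hab
    have := level_le_of_adj hab.symm
    simp only [Set.mem_ofPred_eq] at ha hb
    omega
  · have hm := (reachable_of_levelGraph (S := {w | level G w = level G u} ∪ {x, y}) huv
      fun w hw => Or.inl hw).2
    refine .trans (SimpleGraph.Adj.reachable ⟨hux.symm, by simp, by simp⟩) (.trans hm ?_)
    exact SimpleGraph.Adj.reachable ⟨hvy, Or.inl hlev, by simp⟩
  · have hr : root G x = root G y := by
      refine root_eq_of_reachable (hux.symm.reachable.trans (.trans ?_ hvy.reachable))
      exact huv.mono levelGraph_le
    have h1 := reachable_root_edgesWithin (G := G) (S := {w | level G w < level G x} ∪ {x, y})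
      (v := x) (by simp) fun w hw => Or.inl hw
    have h2 := reachable_root_edgesWithin (G := G) (S := {w | level G w < level G x} ∪ {x, y})
      (v := y) (by simp) fun w hw => Or.inl (show level G w < level G x by omega)
    rw [hr] at h1
    exact h1.trans h2.symm

lemma IsChordal.reachable_levelGraph (hG : IsChordal G) {u v x y : V}
    (huv : (levelGraph G).Reachable u v) (hux : G.Adj u x) (hvy : G.Adj v y)
    (hx : level G x + 1 = level G u) (hy : level G y + 1 = level G v) :
    (levelGraph G).Reachable x y := by
  by_cases hne : x = y
  · rw [hne]
  · have hlev := (reachable_of_levelGraph (S := Set.univ) huv (by simp)).1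
    exact SimpleGraph.Adj.reachable ⟨hG.adj_of_level huv hux hvy hx hy hne, by omega⟩

variable [Fintype V]

/-- A component of a level is small, as all its vertices have a neighbour in a common clique. -/
lemma IsChordal.ncard_level_component_le (hG : IsChordal G) {s : ℕ} (hs : 1 ≤ s)
    (hdeg : ∀ v, (G.neighborSet v).ncard ≤ s) (v : V) :
    {w | (levelGraph G).connectedComponentMk w = (levelGraph G).connectedComponentMk v}.ncard ≤
      (s + 1) * s := by
  classical
  by_cases h0 : level G v = 0
  · have : {w | (levelGraph G).connectedComponentMk w = (levelGraph G).connectedComponentMk v} ⊆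
        {v} := by
      intro w hw
      have hr := (SimpleGraph.ConnectedComponent.exact hw).symm
      have hl := (reachable_of_levelGraph (S := Set.univ) hr (by simp)).1
      rw [Set.mem_singleton_iff, ← eq_root_of_level_eq_zero h0,
        ← eq_root_of_level_eq_zero (hl.trans h0)]
      exact (root_eq_of_reachable (hr.mono levelGraph_le)).symm
    refine (Set.ncard_le_ncard this (Set.toFinite _)).trans ?_
    rw [Set.ncard_singleton]
    nlinarith
  · have hsub : {w | (levelGraph G).connectedComponentMk w =
        (levelGraph G).connectedComponentMk v} ⊆
        ⋃ x ∈ (insert (parent G v) (G.neighborSet (parent G v))).toFinset, G.neighborSet x := by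
      intro w hw
      have hr := (SimpleGraph.ConnectedComponent.exact hw).symm
      have hl := (reachable_of_levelGraph (S := Set.univ) hr (by simp)).1
      have hw0 : level G w ≠ 0 := by omega
      simp only [Set.mem_iUnion, Set.mem_toFinset]
      refine ⟨parent G w, ?_, (adj_parent hw0).symm⟩
      by_cases he : parent G w = parent G v
      · exact Or.inl he
      · exact Or.inr (hG.adj_of_level hr (adj_parent h0) (adj_parent hw0) (level_parent h0)
          (level_parent hw0) (Ne.symm he))
    refine (Set.ncard_le_ncard hsub (Set.toFinite _)).trans ?_
    refine (Finset.set_ncard_biUnion_le _ _).trans ?_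
    refine (Finset.sum_le_card_nsmul _ _ s fun x _ => hdeg x).trans ?_
    rw [smul_eq_mul, ← Set.ncard_eq_toFinset_card']
    gcongr
    exact (Set.ncard_insert_le _ _).trans (by gcongr; exact hdeg _)

/-- The network for a chordal graph: heaps on the components of the levels, and heaps that join
each vertex to its children, with a separate set of heaps for each parity of the level. -/
lemma IsChordal.exists_network (hG : IsChordal G) {s : ℕ} (hs : 1 ≤ s)
    (hdeg : ∀ v, (G.neighborSet v).ncard ≤ s) :
    ∃ N : SimpleGraph V, DegreeBounded N 9 ∧ ∀ u v, G.Adj u v →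
      N.edist u v ≤ (2 * Nat.log 2 (s + 1) + 2 * Nat.log 2 ((s + 1) * s) : ℕ) := by
  classical
  obtain ⟨N₀, hN₀, hd₀⟩ := exists_heap_network (levelGraph G).connectedComponentMk _
    (hG.ncard_level_component_le hs hdeg)
  have star (i : ℕ) : ∃ N : SimpleGraph V, DegreeBounded N 3 ∧
      ∀ v, level G v ≠ 0 → level G v % 2 = i →
        N.edist v (parent G v) ≤ (2 * Nat.log 2 (s + 1) : ℕ) := by
    let f : V → V := fun v => if level G v ≠ 0 ∧ level G v % 2 = i then parent G v else v
    have hf : ∀ v, {w | f w = f v}.ncard ≤ s + 1 := by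
      intro v
      have : {w | f w = f v} ⊆ insert (f v) (G.neighborSet (f v)) := by
        intro w hw
        rw [Set.mem_ofPred_eq] at hw
        rw [← hw]
        by_cases h : level G w ≠ 0 ∧ level G w % 2 = i
        · simp only [f, if_pos h]
          exact Or.inr (adj_parent h.1).symm
        · simp only [f, if_neg h]
          exact Or.inl rfl
      refine (Set.ncard_le_ncard this (Set.toFinite _)).trans ?_
      exact (Set.ncard_insert_le _ _).trans (by gcongr; exact hdeg _)
    obtain ⟨N, hN, hd⟩ := exists_heap_network f _ hf
    refine ⟨N, hN, fun v h0 hi => hd _ _ ?_⟩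
    have h1 := level_parent h0
    simp only [f]
    rw [if_pos ⟨h0, hi⟩, if_neg (by omega)]
  obtain ⟨N₁, hN₁, hd₁⟩ := star 0
  obtain ⟨N₂, hN₂, hd₂⟩ := star 1
  have hle₀ : N₀ ≤ N₀ ⊔ N₁ ⊔ N₂ := le_sup_left.trans le_sup_left
  have hle₁ : N₁ ≤ N₀ ⊔ N₁ ⊔ N₂ := le_sup_right.trans le_sup_left
  have hle₂ : N₂ ≤ N₀ ⊔ N₁ ⊔ N₂ := le_sup_right
  refine ⟨N₀ ⊔ N₁ ⊔ N₂, (hN₀.sup hN₁).sup hN₂, ?_⟩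
  have hpar : ∀ v, level G v ≠ 0 →
      (N₀ ⊔ N₁ ⊔ N₂).edist v (parent G v) ≤ (2 * Nat.log 2 (s + 1) : ℕ) := by
    intro v h0
    rcases Nat.mod_two_eq_zero_or_one (level G v) with h | h
    · exact (SimpleGraph.edist_anti hle₁).trans (hd₁ v h0 h)
    · exact (SimpleGraph.edist_anti hle₂).trans (hd₂ v h0 h)
  have hsame : ∀ u v, (levelGraph G).Reachable u v →
      (N₀ ⊔ N₁ ⊔ N₂).edist u v ≤ (2 * Nat.log 2 ((s + 1) * s) : ℕ) := fun u v h =>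
    (SimpleGraph.edist_anti hle₀).trans (hd₀ u v (SimpleGraph.ConnectedComponent.sound h))
  have hcross : ∀ u v, G.Adj u v → level G v + 1 = level G u →
      (N₀ ⊔ N₁ ⊔ N₂).edist u v ≤
        (2 * Nat.log 2 (s + 1) + 2 * Nat.log 2 ((s + 1) * s) : ℕ) := by
    intro u v hadj hlev
    have h0 : level G u ≠ 0 := by omega
    refine (SimpleGraph.edist_triangle (v := parent G u)).trans ?_
    rw [Nat.cast_add]
    exact add_le_add (hpar u h0)
      (hsame _ _ (hG.reachable_levelGraph (.refl u) (adj_parent h0) hadj (level_parent h0) hlev))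
  intro u v hadj
  have h1 := level_le_of_adj hadj
  have h2 := level_le_of_adj hadj.symm
  obtain h | h | h : level G u = level G v ∨ level G v + 1 = level G u ∨
      level G u + 1 = level G v := by omega
  · refine (hsame u v (SimpleGraph.Adj.reachable ⟨hadj, h⟩)).trans ?_
    exact_mod_cast Nat.le_add_left _ _
  · exact hcross u v hadj h
  · rw [SimpleGraph.edist_comm]
    exact hcross v u hadj.symm h

end Chordal

/-! ### The hypercube -/

lemma hypercube_adj_iff {d : ℕ} {x y : Fin d → Bool} :
    (hypercube d).Adj x y ↔ ∃ j, y = Function.update x j (!x j) := by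
  change hammingDist x y = 1 ↔ _
  rw [hammingDist, Finset.card_eq_one]
  refine exists_congr fun j => ?_
  simp only [Finset.ext_iff, Finset.mem_filter, Finset.mem_univ, true_and, Finset.mem_singleton,
    funext_iff, Function.update_apply]
  refine forall_congr' fun i => ?_
  by_cases h : i = j
  · subst h
    cases x i <;> cases y i <;> simp
  · simp [h, eq_comm]

lemma le_ncard_neighborSet_hypercube {d : ℕ} (x : Fin d → Bool) :
    d ≤ ((hypercube d).neighborSet x).ncard := by
  have hinj : Function.Injective fun j => Function.update x j (!x j) := by
    intro i j hij
    by_contra hne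
    have := congrFun hij i
    simp [Function.update_of_ne hne] at this
  have h : (Set.range fun j => Function.update x j (!x j)) ⊆ (hypercube d).neighborSet x := by
    rintro _ ⟨j, rfl⟩
    exact hypercube_adj_iff.2 ⟨j, rfl⟩
  refine le_trans ?_ (Set.ncard_le_ncard h (Set.toFinite _))
  rw [← Set.image_univ, Set.ncard_image_of_injective _ hinj, Set.ncard_univ]
  simp

/-- The network for the hypercube, in the manner of the cube-connected cycles. The first
`k = ⌈log₂ d⌉` coordinates of a node form an address that names a coordinate. Heaps join the nodes
that differ only in their address, and each node is matched with the one that differs from it in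
the coordinate named by its address. -/
lemma exists_hypercube_network {V : Type*} [Fintype V] {G : SimpleGraph V} {d : ℕ}
    (φ : G ≃g hypercube d) (hd : d ≠ 0) :
    ∃ N : SimpleGraph V, DegreeBounded N 6 ∧ ∀ u v, G.Adj u v →
      N.edist u v ≤ (4 * Nat.clog 2 d + 2 : ℕ) := by
  classical
  set k := Nat.clog 2 d with hk
  have hkd : k ≤ d := Nat.clog_le_of_le_pow (Nat.lt_two_pow_self).le
  obtain ⟨g, hg⟩ : ∃ g : (Fin k → Bool) → Fin d, Function.Surjective g := by
    have : Nonempty (Fin d) := ⟨⟨0, Nat.pos_of_ne_zero hd⟩⟩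
    obtain ⟨e⟩ : Nonempty (Fin d ↪ (Fin k → Bool)) := by
      rw [Function.Embedding.nonempty_iff_card_le]
      simpa using Nat.le_pow_clog (by norm_num) d
    exact ⟨Function.invFun e, Function.invFun_surjective e.injective⟩
  let addr : (Fin d → Bool) → Fin k → Bool := fun x i => x (Fin.castLE hkd i)
  let a : (Fin d → Bool) → Fin d := fun x => g (addr x)
  -- the data of a node: the address is overwritten
  let f₁ : (Fin d → Bool) → Fin d → Bool := fun x i => if (i : ℕ) < k then false else x i
  -- an address that points into itself is not used
  let f₂ : (Fin d → Bool) → Fin d → Bool := fun x =>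
    if k ≤ (a x : ℕ) then Function.update x (a x) false else x
  have addr_update : ∀ x (j : Fin d) b, k ≤ (j : ℕ) → addr (Function.update x j b) = addr x := by
    intro x j b hj
    funext i
    refine Function.update_of_ne ?_ _ _
    rintro rfl
    simp only [Fin.val_castLE] at hj
    omega
  have addr_f₂ : ∀ x, addr (f₂ x) = addr x := by
    intro x
    by_cases h : k ≤ (a x : ℕ)
    · simp only [f₂, if_pos h]
      exact addr_update _ _ _ h
    · simp only [f₂, if_neg h]
  have hf₁ : ∀ v, {w | f₁ (φ w) = f₁ (φ v)}.ncard ≤ 2 ^ k := by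
    intro v
    have hinj : Set.InjOn (fun w => addr (φ w)) {w | f₁ (φ w) = f₁ (φ v)} := by
      intro u hu w hw huw
      refine φ.injective (funext fun i => ?_)
      by_cases hi : (i : ℕ) < k
      · exact congrFun huw ⟨i, hi⟩
      · have := congrFun ((show f₁ (φ u) = f₁ (φ v) from hu).trans
          (show f₁ (φ w) = f₁ (φ v) from hw).symm) i
        simpa [f₁, hi] using this
    rw [← hinj.ncard_image]
    refine (Set.ncard_le_card _).trans ?_
    simp
  have hf₂ : ∀ v, {w | f₂ (φ w) = f₂ (φ v)}.ncard ≤ 2 := by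
    intro v
    have hsub : {w | f₂ (φ w) = f₂ (φ v)} ⊆
        {φ.symm (f₂ (φ v)), φ.symm (Function.update (f₂ (φ v)) (a (φ v)) true)} := by
      intro w hw
      have hw' : f₂ (φ w) = f₂ (φ v) := hw
      have ha : a (φ w) = a (φ v) := by
        simp only [a]
        rw [← addr_f₂, hw', addr_f₂]
      rw [← hw', ← ha]
      by_cases h : k ≤ (a (φ w) : ℕ)
      · simp only [f₂, if_pos h, Function.update_idem]
        rcases hb : φ w (a (φ w)) with _ | _
        · left
          rw [← hb, Function.update_eq_self]
          simp
        · right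
          rw [← hb, Function.update_eq_self]
          simp
      · simp [f₂, if_neg h]
    exact (Set.ncard_le_ncard hsub (Set.toFinite _)).trans ((Set.ncard_insert_le _ _).trans (by simp))
  obtain ⟨N₁, hN₁, hd₁⟩ := exists_heap_network (fun v => f₁ (φ v)) _ hf₁
  obtain ⟨N₂, hN₂, hd₂⟩ := exists_heap_network (fun v => f₂ (φ v)) _ hf₂
  rw [Nat.log_pow (by norm_num)] at hd₁
  refine ⟨N₁ ⊔ N₂, hN₁.sup hN₂, fun u v huv => ?_⟩
  have hd₁' : ∀ x y, f₁ x = f₁ y →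
      (N₁ ⊔ N₂).edist (φ.symm x) (φ.symm y) ≤ (2 * k : ℕ) := fun x y h =>
    (SimpleGraph.edist_anti le_sup_left).trans (hd₁ _ _ (by simpa using h))
  have hd₂' : ∀ x y, f₂ x = f₂ y → (N₁ ⊔ N₂).edist (φ.symm x) (φ.symm y) ≤ (2 : ℕ) := fun x y h =>
    (SimpleGraph.edist_anti le_sup_right).trans
      ((hd₂ _ _ (by simpa using h)).trans (by rw [Nat.log_eq_one_iff.2 (by norm_num)]))
  obtain ⟨j, hj⟩ := hypercube_adj_iff.1 (φ.map_adj_iff.2 huv)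
  obtain ⟨x, rfl⟩ := φ.symm.surjective u
  obtain ⟨y, rfl⟩ := φ.symm.surjective v
  simp only [RelIso.apply_symm_apply] at hj
  by_cases hjk : (j : ℕ) < k
  · refine (hd₁' x y ?_).trans (by norm_cast; omega)
    funext i
    by_cases hi : (i : ℕ) < k
    · simp [f₁, hi]
    · have : i ≠ j := by rintro rfl; exact hi hjk
      simp [f₁, hi, hj, this]
  · obtain ⟨b, hb⟩ := hg j
    -- walk to the address of `j`, flip `j`, and restore the address
    let x' : Fin d → Bool := fun i => if h : (i : ℕ) < k then b ⟨i, h⟩ else x i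
    let y' : Fin d → Bool := fun i => if h : (i : ℕ) < k then b ⟨i, h⟩ else y i
    have hax : a x' = j := by
      have : addr x' = b := by
        funext i
        simp [addr, x']
      simp only [a, this, hb]
    have hay : a y' = j := by
      have : addr y' = b := by
        funext i
        simp [addr, y']
      simp only [a, this, hb]
    have h1 : f₁ x = f₁ x' := by
      funext i
      by_cases hi : (i : ℕ) < k <;> simp [f₁, x', hi]
    have h3 : f₁ y' = f₁ y := by
      funext i
      by_cases hi : (i : ℕ) < k <;> simp [f₁, y', hi]
    have h2 : f₂ x' = f₂ y' := by
      simp only [f₂, hax, hay, if_pos (not_lt.1 hjk)]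
      funext i
      by_cases hij : i = j
      · simp [hij]
      · simp [hij, x', y', hj]
    calc (N₁ ⊔ N₂).edist (φ.symm x) (φ.symm y)
        ≤ (N₁ ⊔ N₂).edist (φ.symm x) (φ.symm x') + ((N₁ ⊔ N₂).edist (φ.symm x') (φ.symm y') +
            (N₁ ⊔ N₂).edist (φ.symm y') (φ.symm y)) :=
          SimpleGraph.edist_triangle.trans (add_le_add_right SimpleGraph.edist_triangle _)
      _ ≤ (2 * k : ℕ) + ((2 : ℕ) + (2 * k : ℕ)) := by
          gcongr
          · exact hd₁' _ _ h1
          · exact hd₂' _ _ h2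
          · exact hd₁' _ _ h3
      _ = (4 * k + 2 : ℕ) := by
          norm_cast
          omega

/-! ### Comparison with the entropies -/

lemma natLog_le_mul_logb {r M e : ℕ} (hr : 2 ≤ r) (h : M ≤ r ^ e) :
    (Nat.log 2 M : ℝ) ≤ e * Real.logb 2 r := by
  rcases Nat.eq_zero_or_pos M with rfl | hM
  · have := Real.logb_nonneg (b := 2) (x := r) (by norm_num) (by exact_mod_cast (by omega : 1 ≤ r))
    simp only [Nat.log_zero_right, Nat.cast_zero]
    positivity
  · calc (Nat.log 2 M : ℝ) ≤ Real.logb 2 M := Real.natLog_le_logb M 2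
      _ ≤ Real.logb 2 ((r : ℝ) ^ e) :=
        Real.logb_le_logb_of_le (by norm_num) (by exact_mod_cast hM) (by exact_mod_cast h)
      _ = e * Real.logb 2 r := Real.logb_pow _ _ _

lemma one_le_logb {r : ℕ} (hr : 2 ≤ r) : 1 ≤ Real.logb 2 r := by
  rw [Real.le_logb_iff_rpow_le (by norm_num) (by exact_mod_cast (by omega : 0 < r))]
  simpa using (by exact_mod_cast hr : (2 : ℝ) ≤ r)

lemma exists_network_of_rpow_le {n r : ℕ} (D : Demand (Fin n)) (hr : 2 ≤ r) {c : ℝ} (hc : 1 ≤ c)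
    (h : (n : ℝ) ^ (1 / c) ≤ (2 * r : ℕ)) :
    ∃ N : SimpleGraph (Fin n), DegreeBounded N 9 ∧
      epl D N ≤ ENNReal.ofReal (8 * c * (2 * Real.logb 2 r)) := by
  obtain ⟨N, hN, hd⟩ := exists_heap_network (fun _ : Fin n => ()) n
    (fun _ => (Set.ncard_le_card _).trans (by simp))
  refine ⟨N, hN.mono (by norm_num), (epl_le_of_edist_le fun u v _ => hd u v rfl).trans ?_⟩
  rw [← ENNReal.ofReal_natCast]
  refine ENNReal.ofReal_le_ofReal ?_
  have hr1 := one_le_logb hr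
  have hc0 : 0 < c := by linarith
  have hn : Real.logb 2 n ≤ c * (2 * Real.logb 2 r) := by
    rcases Nat.eq_zero_or_pos n with rfl | hn
    · simp only [Nat.cast_zero, Real.logb_zero]
      positivity
    · have hn' : (0 : ℝ) < n := by exact_mod_cast hn
      have h1 := Real.logb_le_logb_of_le (b := 2) (by norm_num) (by positivity) h
      rw [Real.logb_rpow_eq_mul_logb_of_pos hn', Nat.cast_mul, Nat.cast_ofNat,
        Real.logb_mul (by norm_num) (by exact_mod_cast (by omega : r ≠ 0)),
        Real.logb_self_eq_one (by norm_num), one_div, inv_mul_le_iff₀ hc0] at h1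
      exact h1.trans (by gcongr; linarith)
  have hlog := Real.natLog_le_logb n 2
  push_cast at hlog ⊢
  nlinarith [mul_pos hc0 (by linarith : 0 < Real.logb 2 r)]

lemma exists_network_of_hypercube {n r d : ℕ} {D : Demand (Fin n)} (hreg : IsRegular D r)
    (hr : 2 ≤ r) (φ : demandGraph D ≃g hypercube d) :
    ∃ N : SimpleGraph (Fin n), DegreeBounded N 9 ∧
      epl D N ≤ ENNReal.ofReal (8 * (2 * Real.logb 2 r)) := by
  have hr1 := one_le_logb hr
  rcases Nat.eq_zero_or_pos d with rfl | hd
  · refine ⟨⊥, fun v => by simp, (epl_le_of_demandGraph (B := 0) fun u v huv => ?_).trans (by simp)⟩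
    exact absurd (φ.injective (Subsingleton.elim _ _)) huv.1
  · have hdr : d ≤ r ^ 2 := by
      have h1 := le_ncard_neighborSet_hypercube (fun _ : Fin d => false)
      have h2 := hreg.ncard_neighborSet_le (φ.symm fun _ => false)
      have h3 : ((demandGraph D).neighborSet (φ.symm fun _ => false)).ncard =
          ((hypercube d).neighborSet fun _ => false).ncard := by
        have := Nat.card_congr (φ.mapNeighborSet (φ.symm fun _ => false))
        simpa using this
      nlinarith
    obtain ⟨N, hN, hdist⟩ := exists_hypercube_network φ hd.ne'
    refine ⟨N, hN.mono (by norm_num), (epl_le_of_demandGraph hdist).trans ?_⟩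
    rw [← ENNReal.ofReal_natCast]
    refine ENNReal.ofReal_le_ofReal ?_
    have hclog : Nat.clog 2 d ≤ Nat.log 2 d + 1 :=
      Nat.clog_le_of_le_pow (Nat.lt_pow_succ_log_self (by norm_num) d).le
    have hclog' : (Nat.clog 2 d : ℝ) ≤ Nat.log 2 d + 1 := by exact_mod_cast hclog
    have hlog := natLog_le_mul_logb hr hdr
    push_cast at hlog ⊢
    linarith

lemma exists_network_of_chordal {n r : ℕ} {D : Demand (Fin n)} (hreg : IsRegular D r)
    (hr : 2 ≤ r) (hG : IsChordal (demandGraph D)) :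
    ∃ N : SimpleGraph (Fin n), DegreeBounded N 9 ∧
      epl D N ≤ ENNReal.ofReal (8 * (2 * Real.logb 2 r)) := by
  obtain ⟨N, hN, hdist⟩ := hG.exists_network (s := 2 * r) (by omega) hreg.ncard_neighborSet_le
  refine ⟨N, hN, (epl_le_of_demandGraph hdist).trans ?_⟩
  rw [← ENNReal.ofReal_natCast]
  refine ENNReal.ofReal_le_ofReal ?_
  -- the route length is at most `2 * 3 + 2 * 5 = 16` times `log₂ r`, which the constant `8` allows
  have h2 : 2 * r ≤ r ^ 2 := by nlinarith
  have h3 : 2 * r + 1 ≤ r ^ 3 := by nlinarith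
  have hlog₁ := natLog_le_mul_logb hr h3
  have hlog₂ := natLog_le_mul_logb (M := (2 * r + 1) * (2 * r)) (e := 5) hr (by
    calc (2 * r + 1) * (2 * r) ≤ r ^ 3 * r ^ 2 := Nat.mul_le_mul h3 h2
      _ = r ^ 5 := by ring)
  push_cast at hlog₁ hlog₂ ⊢
  linarith

end DAN

theorem corollary1 :
    ∃ (Δ : ℕ) (K : ℝ), 0 < K ∧
      ∀ (n : ℕ) (D : DAN.Demand (Fin n)) (r : ℕ),
        DAN.IsUniform D → DAN.IsRegular D r → 2 ≤ r →
          -- minimum degree at least `n ^ (1 / c)`, with a constant linear in `c`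
          (∀ c : ℝ, 1 ≤ c →
            (∀ v, (n : ℝ) ^ (1 / c) ≤ (DAN.outDegree D v + DAN.inDegree D v : ℕ)) →
            ∃ N : SimpleGraph (Fin n), DAN.DegreeBounded N Δ ∧
              DAN.epl D N ≤
                ENNReal.ofReal (K * c * (DAN.condEntropyDstSrc D + DAN.condEntropySrcDst D))) ∧
          -- the demand graph is a hypercube
          ((∃ d : ℕ, Nonempty (DAN.demandGraph D ≃g DAN.hypercube d)) →
            ∃ N : SimpleGraph (Fin n), DAN.DegreeBounded N Δ ∧
              DAN.epl D N ≤
                ENNReal.ofReal (K * (DAN.condEntropyDstSrc D + DAN.condEntropySrcDst D))) ∧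
          -- the demand graph is chordal
          (DAN.IsChordal (DAN.demandGraph D) →
            ∃ N : SimpleGraph (Fin n), DAN.DegreeBounded N Δ ∧
              DAN.epl D N ≤
                ENNReal.ofReal (K * (DAN.condEntropyDstSrc D + DAN.condEntropySrcDst D))) := by
  refine ⟨9, 8, by norm_num, fun n D r hD hreg hr => ?_⟩
  rw [DAN.condEntropy_add hD hreg]
  refine ⟨fun c hc h => DAN.exists_network_of_rpow_le D hr hc ?_,
    fun ⟨d, ⟨φ⟩⟩ => DAN.exists_network_of_hypercube hreg hr φ,
    fun hG => DAN.exists_network_of_chordal hreg hr hG⟩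
  obtain ⟨e, -⟩ := D.support_nonempty
  have hv := h e.1
  rwa [(hreg e.1).1, (hreg e.1).2, ← two_mul] at hv
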